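/- **Model.** There are $n=3f+1$ processes, at most $f$ of them Byzantine, and synchronous rounds $0,1,2,\dots$ Messages are sent at the beginning of a round. A message between two different processes is received unaltered in the same round or omitted (lost or late), and any messages may be omitted; a process always receives its own messages. Byzantine processes collude and send arbitrary messages, different ones to different processes, but cannot forge signatures of non-Byzantine processes (they may replay any signature already made, including in the current round). Messages with an incorrect signature are ignored. Every process broadcasts at most one value. **Algorithm RT-ByzCast, with window $R>1$.** A non-Byzantine process $j$ starts alive and, until it crashes itself (it is then dead forever and sends nothing), acts as follows, separately for each possible sender $i$. * *Broadcast.* To broadcast $v$ in round $r$, $j$ sends in every round $\ge r$ its signed payload $m=(r,v)$ to all, until it has delivered a message with sender $j$. * *Echo.* When $j$, having delivered nothing with sender $i$, first receives a payload $m$ signed by $i$ (in a broadcast message, whose stamp must not exceed the current round, or in an echo), in round $t$, it echoes $m$ from round $t+1$ on: in every round it sends $\mathrm{Echo}_j(i,m)$ and each received $\mathrm{Echo}_k(i,m)$, with all known signatures on it and its own. It never signs an echo of another payload of $i$. If it receives several payloads of $i$ in that round, any of them may be the first. * *Deliver.* If $j$ has delivered nothing with sender $i$, it delivers the value of the payload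 $m$ that it echoes as soon as, for some $k$, at least $2f+1$ processes (counting $j$) have signed $\mathrm{Echo}_k(i,m)$; these signatures form a certificate. It also delivers on receiving a $\mathrm{Deliver}$ message for sender $i$ with a certificate of at least $2f+1$ correct signatures (with fewer, the message is ignored). If it delivers in round $t$, it stops sending echoes and broadcasts for $i$ and sends, in rounds $t+1,\dots,t+1+2R$, signed $\mathrm{Deliver}$ messages with the certificate and all known signatures on $\mathrm{Deliver}$ messages for that value; this period restarts whenever it receives a $\mathrm{Deliver}$ message for $i$ from another process. * *Proof of life.* In every round $h$, $j$ sends a signed heartbeat $\{j,h\}$; having received a heartbeat $\{i,h\}$ signed by $i$, it resends it in every later round up to $h+R$, with all known signatures on it and its own. Heartbeats are piggybacked on the broadcast, echo and deliver messages that $j$ is sending in that round, if any; its signature on a piggybacked heartbeat covers these messages as well, so that it cannot be passed on without them. * *Self-crash.* Messages received in round $t$ are processed first; $j$ then crashes itself at the end of round $t$ if one of the following holds. 1. For some $i$, $j$ broadcast in round $r'$ (and $i=j$) or started to echo a payload of $i$ from round $r'$ on, $t\ge r'+R$, no value of $i$ has more than $2f$ signers for $j$ (the signers in the certificate of the value that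 $j$ delivered, or, if it has delivered none, the known signers of $j$'s own echo, counting $j$), and $j$ does not know two different values signed by $i$. 2. For some $i$, $j$ delivered a value with sender $i$ in round $r'$, $t\ge r'+R$, and it knows at most $2f$ processes (counting $j$) that signed $\mathrm{Deliver}$ messages for that value. 3. $t\ge R-1$ and in rounds $t-R+1,\dots,t$ it received (directly or relayed) signatures of at most $2f$ processes. 4. $t\ge R$ and the signatures that it has received on its own heartbeats $\{j,h\}$, $t-R\le h\le t$, come from at most $2f$ processes. A process is *correct* if it is non-Byzantine and never crashes itself. **Theorem.** Every execution of RT-ByzCast has the properties of real-time Byzantine reliable broadcast (RTBRB) with $\Delta=3R$ rounds: * *Validity:* if a correct process broadcasts $v$, then some correct process eventually delivers $v$. * *No duplication:* a correct process delivers at most one message of each sender, at most once. * *Integrity:* if a correct process delivers $v$ with sender $i$ and $i$ is correct, then $i$ previously broadcast $v$. * *Agreement:* if a correct process delivers $v$ with sender $i$ (correct or not), then every correct process eventually delivers $v$ with sender $i$. * *Timeliness:* if a correct process broadcasts $v$ in round $r$, then no correct process delivers $v$ (with that sender) after round $r+3R$. Moreover, if a non-Byzantine process $i$ broadcasts $v$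 in round $r$ and does not crash itself through round $r+3R$, then every non-Byzantine process that does not crash itself through round $r+3R$ delivers $v$ with sender $i$ in some round of $[r,r+3R]$. -/

import Mathlib

/-! Processes are the elements of `Fin n`, rounds are natural numbers. Signatures are symbolic and
unforgeable: a message is the set of the signatures that it transmits, each of them together with
the data it signs. Messages with an incorrect signature are ignored by their receivers, so that
receiving one is the same as an omission; hence only correct signatures occur in messages. -/

namespace RTByzCast

/-- The stamped value `(r, v)` that a broadcasting process signs: `r` is the round in which the
broadcast is issued and `v` the value. -/
structure Payload (V : Type*) where
  round : ℕ
  value : V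

/-- A certificate: the signers of at least `2 f + 1` signatures. A `Deliver` message with fewer
signatures in it is invalid and is ignored; hence it is not represented. -/
abbrev Quorum (n f : ℕ) : Type := {S : Finset (Fin n) // 2 * f + 1 ≤ S.card}

/-- What processes sign, besides heartbeats.
* `bcast m`, signed by `i`, is `RTBRB-broadcast((i, m.round, m.value); Φ_i)`.
* `echo k i m`, signed by `x`, is the signature of `x` on `Echo_k((i, m.round, m.value; Φ_i))`,
  the echo issued by `k` of the broadcast `m` of `i`. It includes the signature `Φ_i` of `i` on `m`.
* `deliver i m k S`, signed by `x`, is the signature of `x` on `Deliver((i, m.value, sigs))`, where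
  `sigs` consists of the signatures of the members of `S` on `Echo_k((i, m.round, m.value; Φ_i))`.
-/
inductive Act (n f : ℕ) (V : Type*) where
  | bcast (m : Payload V)
  | echo (k i : Fin n) (m : Payload V)
  | deliver (i : Fin n) (m : Payload V) (k : Fin n) (S : Quorum n f)

/-- A signature of the process `x`.
* `act x a`: on `a`.
* `hb x i h c`: on the heartbeat `{i, h}` that `i` issued in round `h`, piggybacked on the messages
  `c` which `x` is sending. A heartbeat that is piggybacked is signed together with its carrier; it
  is not piggybacked when `c` is empty. -/
inductive Sig (n f : ℕ) (V : Type*) where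
  | act (x : Fin n) (a : Act n f V)
  | hb (x i : Fin n) (h : ℕ) (c : Set (Act n f V))

/-- The process that made a signature. -/
def Sig.signer {n f : ℕ} {V : Type*} : Sig n f V → Fin n
  | .act x _ => x
  | .hb x _ _ _ => x

/-- `SignedIn M x a`: the message `M` contains the signature of `x` on `a`, by itself, in the
carrier of a heartbeat, in the certificate of a `Deliver`, or as the signature `Φ_i` of the
broadcasting process in an `Echo`. -/
inductive SignedIn {n f : ℕ} {V : Type*} (M : Set (Sig n f V)) : Fin n → Act n f V → Prop
  | direct {x : Fin n} {a : Act n f V} : Sig.act x a ∈ M → SignedIn M x a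
  | carrier {x i : Fin n} {h : ℕ} {c : Set (Act n f V)} {a : Act n f V} :
      Sig.hb x i h c ∈ M → a ∈ c → SignedIn M x a
  | cert {x y i k : Fin n} {m : Payload V} {S : Quorum n f} :
      SignedIn M y (.deliver i m k S) → x ∈ S.1 → SignedIn M x (.echo k i m)
  | origin {y i k : Fin n} {m : Payload V} :
      SignedIn M y (.echo k i m) → SignedIn M i (.bcast m)

/-- Everything a process receives: `I t p` is what it receives in round `t` on the link from `p`. -/
abbrev Inbox (n f : ℕ) (V : Type*) : Type _ := ℕ → Fin n → Set (Sig n f V)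

/-- The signatures received in round `t`. -/
def Inbox.during {n f : ℕ} {V : Type*} (I : Inbox n f V) (t : ℕ) : Set (Sig n f V) :=
  {σ | ∃ p, σ ∈ I t p}

/-- The signatures received before the beginning of round `t`. -/
def Inbox.before {n f : ℕ} {V : Type*} (I : Inbox n f V) (t : ℕ) : Set (Sig n f V) :=
  {σ | ∃ t' < t, σ ∈ I.during t'}

/-- A delivery of `msg` in round `round`, with the certificate of the signatures of `cert` on the
echo of `msg` issued by `via`. -/
structure Delivery (n f : ℕ) (V : Type*) where
  msg : Payload V
  via : Fin n
  cert : Quorum n f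
  round : ℕ

/-- The local state of a process, relative to every possible broadcasting process `i`.
* `dead`: it is in the Dead-State.
* `echo i = some (m, r)`: `m` is the first broadcast of `i` it heard of, which it echoes as of
  round `r`, the round with which its set `R_echo(i, r, ·)` is initialised.
* `dlv i`: what it has delivered from `i`, if anything.
* `sendUntil i`: the last round in which it sends `Deliver` messages relative to `i`. -/
structure LState (n f : ℕ) (V : Type*) where
  dead : Prop
  echo : Fin n → Option (Payload V × ℕ)
  dlv : Fin n → Option (Delivery n f V)
  sendUntil : Fin n → ℕ

/-- The state after the initiation signal: alive, nothing heard of, nothing delivered. -/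
def LState.initial (n f : ℕ) (V : Type*) : LState n f V where
  dead := False
  echo := fun _ => none
  dlv := fun _ => none
  sendUntil := fun _ => 0

section Algorithm

variable {n f : ℕ} {V : Type*}

/-! ### What a process sends

`j` is the process, `req` its broadcast request (`some (r, v)`: it wants to broadcast `v` in round
`r`), `t` the round, `s` its state at the beginning of the round, and `K` the set of the signatures
it has received before. -/

/-- The messages that `j` sends and signs in round `t`. It sends its own broadcast periodically;
it sends its own echo of the value it echoes, and the echoes of that value it has received, to which
it appends its signature. When it has delivered a message of `i` it stops both and only sends
`Deliver`. -/
inductive acts (j : Fin n) (req : Option (ℕ × V)) (t : ℕ) (s : LState n f V)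
    (K : Set (Sig n f V)) : Set (Act n f V)
  | bcast {r : ℕ} {v : V} : req = some (r, v) → r ≤ t → s.dlv j = none →
      acts j req t s K (.bcast ⟨r, v⟩)
  | echo {i k : Fin n} {m : Payload V} {r : ℕ} : s.dlv i = none → s.echo i = some (m, r) →
      (k = j ∨ ∃ y, SignedIn K y (.echo k i m)) → acts j req t s K (.echo k i m)
  | deliver {i : Fin n} {d : Delivery n f V} : s.dlv i = some d → t ≤ s.sendUntil i →
      acts j req t s K (.deliver i d.msg d.via d.cert)

/-- The signatures that `j` makes in round `t`: on the messages it sends, on its own heartbeat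
`{j, t}`, and on each heartbeat `{i, h}` it has received (signed by `i`), up to round `h + R`.
The heartbeats are piggybacked on the messages it sends. -/
inductive ownSigs (R : ℕ) (j : Fin n) (req : Option (ℕ × V)) (t : ℕ) (s : LState n f V)
    (K : Set (Sig n f V)) : Set (Sig n f V)
  | act {a : Act n f V} : a ∈ acts j req t s K → ownSigs R j req t s K (.act j a)
  | heartbeat : ownSigs R j req t s K (.hb j j t (acts j req t s K))
  | relay {i : Fin n} {h : ℕ} {c : Set (Act n f V)} : Sig.hb i i h c ∈ K → t ≤ h + R →
      ownSigs R j req t s K (.hb j i h (acts j req t s K))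

/-- The signatures of other processes that `j` aggregates to its own and retransmits. -/
inductive relayed (R : ℕ) (t : ℕ) (s : LState n f V) (K : Set (Sig n f V)) : Set (Sig n f V)
  | heartbeat {x i : Fin n} {h : ℕ} {c c' : Set (Act n f V)} : Sig.hb i i h c' ∈ K →
      Sig.hb x i h c ∈ K → t ≤ h + R → relayed R t s K (.hb x i h c)
  | echo {x i k : Fin n} {m : Payload V} {r : ℕ} : s.dlv i = none → s.echo i = some (m, r) →
      SignedIn K x (.echo k i m) → relayed R t s K (.act x (.echo k i m))
  | deliver {x i k : Fin n} {d : Delivery n f V} {m : Payload V} {S : Quorum n f} :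
      s.dlv i = some d → t ≤ s.sendUntil i → m.value = d.msg.value →
      SignedIn K x (.deliver i m k S) → relayed R t s K (.act x (.deliver i m k S))

/-- The message that `j` sends to all processes at the beginning of round `t`. A process in the
Dead-State sends nothing. -/
def message (R : ℕ) (j : Fin n) (req : Option (ℕ × V)) (t : ℕ) (s : LState n f V)
    (K : Set (Sig n f V)) : Set (Sig n f V) :=
  {σ | ¬ s.dead ∧ (σ ∈ ownSigs R j req t s K ∨ σ ∈ relayed R t s K)}

/-! ### What a process does with the messages it receives in a round -/

/-- In round `t` the process receives an `RTBRB-broadcast` or an `Echo` of the broadcast `m`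
of `i`. -/
def Heard (I : Inbox n f V) (t : ℕ) (i : Fin n) (m : Payload V) : Prop :=
  (SignedIn (I.during t) i (.bcast m) ∧ m.round ≤ t) ∨
    ∃ y k, SignedIn (I.during t) y (.echo k i m)

/-- `aggregate-sig`: the signers that `j` knows on the echo issued by `k` of the broadcast `m` of
`i`, and `j` itself. -/
def aggregate (j k i : Fin n) (m : Payload V) (K : Set (Sig n f V)) : Set (Fin n) :=
  {y | y = j ∨ SignedIn K y (.echo k i m)}

/-- The possible deliveries, relative to `i`, at the end of round `t`: the value that `j` echoes
(`s'` is the state after that value is updated), once more than `2 f` signatures on one of its echoes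
are aggregated, and a value for which a `Deliver` message is received. -/
def CanDeliver (j : Fin n) (I : Inbox n f V) (t : ℕ) (s' : LState n f V) (i : Fin n)
    (d : Delivery n f V) : Prop :=
  d.round = t ∧
    ((∃ r, s'.echo i = some (d.msg, r) ∧
        (d.cert.1 : Set (Fin n)) = aggregate j d.via i d.msg (I.before (t + 1))) ∨
      ∃ y, SignedIn (I.during t) y (.deliver i d.msg d.via d.cert))

/-- `R_echo(i, ·, v)`: the signers in the certificate of `v` if `v` is delivered; before anything is
delivered, those of the echo of `v` issued by `j` itself. -/
def echoSet (j i : Fin n) (s : LState n f V) (K : Set (Sig n f V)) (v : V) : Set (Fin n) :=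
  {y | (∃ d, s.dlv i = some d ∧ d.msg.value = v ∧ y ∈ d.cert.1) ∨
    (s.dlv i = none ∧ ∃ m r, s.echo i = some (m, r) ∧ m.value = v ∧ y ∈ aggregate j j i m K)}

/-- `R_deliver(i, ·)` when `v` is delivered: the known signers of `Deliver` messages for `v`, and
`j` itself. -/
def deliverSet (j i : Fin n) (K : Set (Sig n f V)) (v : V) : Set (Fin n) :=
  {y | y = j ∨ ∃ m k S, m.value = v ∧ SignedIn K y (.deliver i m k S)}

/-- `j` initialised `R_echo(i, r, ·)`: it is the broadcasting process and issued its broadcast in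
round `r`, or it echoes a broadcast of `i` as of round `r`. -/
def EchoInit (j : Fin n) (req : Option (ℕ × V)) (t : ℕ) (s : LState n f V) (i : Fin n) (r : ℕ) :
    Prop :=
  (i = j ∧ r ≤ t ∧ ∃ v, req = some (r, v)) ∨ ∃ m, s.echo i = some (m, r)

/-- The process can verify that `i` sent two different values. -/
def DiscoveredLie (i : Fin n) (K : Set (Sig n f V)) : Prop :=
  ∃ m m' : Payload V, m.value ≠ m'.value ∧ SignedIn K i (.bcast m) ∧ SignedIn K i (.bcast m')

/-- Lack of echoes: no value of `i` gathered more than `2 f` signatures within `R` rounds, and no lie of `i`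
is discovered. -/
def CrashEcho (R : ℕ) (j : Fin n) (req : Option (ℕ × V)) (I : Inbox n f V) (t : ℕ)
    (s : LState n f V) : Prop :=
  ∃ i r, EchoInit j req t s i r ∧ (∀ v, (echoSet j i s (I.before (t + 1)) v).ncard ≤ 2 * f) ∧
    r + R ≤ t ∧ ¬ DiscoveredLie i (I.before (t + 1))

/-- Lack of deliveries: at most `2 f` processes signed `Deliver` messages for the delivered value within `R`
rounds. -/
def CrashDeliver (R : ℕ) (j : Fin n) (I : Inbox n f V) (t : ℕ) (s : LState n f V) : Prop :=
  ∃ i d, s.dlv i = some d ∧ (deliverSet j i (I.before (t + 1)) d.msg.value).ncard ≤ 2 * f ∧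
    d.round + R ≤ t

/-- Disconnection: in the last `R` rounds the process heard, directly or via others, from at most `2 f`
processes. -/
def CrashSilence (R : ℕ) (I : Inbox n f V) (t : ℕ) : Prop :=
  R ≤ t + 1 ∧
    {x | ∃ t', t' ≤ t ∧ t < t' + R ∧ ∃ σ ∈ I.during t', σ.signer = x}.ncard ≤ 2 * f

/-- Failed proof-of-life: the signatures received on the heartbeats that `j` issued in the rounds
`t - R, …, t` are those of at most `2 f` processes. -/
def CrashHeartbeat (R : ℕ) (j : Fin n) (I : Inbox n f V) (t : ℕ) : Prop :=
  R ≤ t ∧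
    {x | ∃ h c, t ≤ h + R ∧ h ≤ t ∧ Sig.hb x j h c ∈ I.before (t + 1)}.ncard ≤ 2 * f

/-- The process crashes itself at the end of round `t`. -/
def Crash (R : ℕ) (j : Fin n) (req : Option (ℕ × V)) (I : Inbox n f V) (t : ℕ)
    (s : LState n f V) : Prop :=
  CrashEcho R j req I t s ∨ CrashDeliver R j I t s ∨ CrashSilence R I t ∨ CrashHeartbeat R j I t

/-- `Step R j req I t s s'`: the non-Byzantine process `j`, in state `s` at the beginning of round
`t`, can be in state `s'` at its end. If several values of `i` are first heard of in the same round,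
any of them may be the first one. -/
structure Step (R : ℕ) (j : Fin n) (req : Option (ℕ × V)) (I : Inbox n f V) (t : ℕ)
    (s s' : LState n f V) : Prop where
  /-- A process in the Dead-State remains there and does nothing. -/
  dead : s.dead → s' = s
  echo_kept : ¬ s.dead → ∀ i, (s.dlv i ≠ none ∨ s.echo i ≠ none) → s'.echo i = s.echo i
  echo_new : ¬ s.dead → ∀ i, s.dlv i = none → s.echo i = none →
    (∃ m, Heard I t i m ∧ s'.echo i = some (m, t + 1)) ∨
      ((∀ m, ¬ Heard I t i m) ∧ s'.echo i = none)
  dlv_kept : ¬ s.dead → ∀ i, s.dlv i ≠ none → s'.dlv i = s.dlv i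
  dlv_new : ¬ s.dead → ∀ i, s.dlv i = none →
    (∃ d, CanDeliver j I t s' i d ∧ s'.dlv i = some d) ∨
      ((∀ d, ¬ CanDeliver j I t s' i d) ∧ s'.dlv i = none)
  /-- `Deliver` is sent up to round `t + 1 + 2 R` after it is delivered in round `t`, or after another
  `Deliver` message relative to `i` arrives from another process in round `t`. -/
  send_set : ¬ s.dead → ∀ i, s'.dlv i ≠ none →
    (s.dlv i = none ∨ ∃ p ≠ j, ∃ y m k S, SignedIn (I t p) y (.deliver i m k S)) →
      s'.sendUntil i = t + 1 + 2 * R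
  send_kept : ¬ s.dead → ∀ i,
    ¬ (s'.dlv i ≠ none ∧
      (s.dlv i = none ∨ ∃ p ≠ j, ∃ y m k S, SignedIn (I t p) y (.deliver i m k S))) →
      s'.sendUntil i = s.sendUntil i
  crash : ¬ s.dead → (s'.dead ↔ Crash R j req I t s')

end Algorithm

/-! ### Executions -/

/-- A run of the system: the Byzantine processes, the broadcast requests of the application (each
process broadcasts at most one message), what every process receives in every round on every link,
and the state of every process at the beginning of every round. -/
structure Run (n f : ℕ) (V : Type*) where
  byz : Finset (Fin n)
  request : Fin n → Option (ℕ × V)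
  inbox : Fin n → Inbox n f V
  state : ℕ → Fin n → LState n f V

namespace Run

variable {n f : ℕ} {V : Type*}

/-- The signatures that the process `p` itself makes, and sends, in round `t`. -/
def signed (e : Run n f V) (R : ℕ) (t : ℕ) (p : Fin n) : Set (Sig n f V) :=
  {σ | ¬ (e.state t p).dead ∧
    σ ∈ ownSigs R p (e.request p) t (e.state t p) ((e.inbox p).before t)}

/-- The message that the process `p` sends in round `t`. -/
def sent (e : Run n f V) (R : ℕ) (t : ℕ) (p : Fin n) : Set (Sig n f V) :=
  message R p (e.request p) t (e.state t p) ((e.inbox p).before t)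

/-- `e` is an execution of RT-ByzCast with time window `R`. The non-Byzantine processes follow the
algorithm. A message between two different non-Byzantine processes is received unaltered in the round
in which it is sent, or is omitted (lost or late); any message may be omitted. The Byzantine processes
send arbitrary messages, different ones to different processes, except that they cannot forge the
signatures of non-Byzantine processes: a signature of `x` can occur only if `x` has made it. -/
structure IsExecution (e : Run n f V) (R : ℕ) : Prop where
  init : ∀ p ∉ e.byz, e.state 0 p = LState.initial n f V
  step : ∀ t, ∀ p ∉ e.byz,
    Step R p (e.request p) (e.inbox p) t (e.state t p) (e.state (t + 1) p)
  link_self : ∀ t, ∀ p ∉ e.byz, e.inbox p t p = e.sent R t p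
  link : ∀ t, ∀ p ∉ e.byz, ∀ q ∉ e.byz, p ≠ q →
    e.inbox q t p = e.sent R t p ∨ e.inbox q t p = ∅
  unforgeable : ∀ t, ∀ p ∈ e.byz, ∀ q ∉ e.byz, ∀ x ∉ e.byz,
    (∀ i h c, Sig.hb x i h c ∈ e.inbox q t p → ∃ t' ≤ t, Sig.hb x i h c ∈ e.signed R t' x) ∧
    (∀ a, SignedIn (e.inbox q t p) x a → ∃ t' ≤ t, SignedIn (e.signed R t' x) x a)

/-- `p` is non-Byzantine and does not crash itself in any of the rounds `0, …, t`. -/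
def CorrectThrough (e : Run n f V) (t : ℕ) (p : Fin n) : Prop :=
  p ∉ e.byz ∧ ∀ t' ≤ t, ¬ (e.state (t' + 1) p).dead

/-- `p` is correct: non-Byzantine, and it never crashes itself. -/
def Correct (e : Run n f V) (p : Fin n) : Prop :=
  p ∉ e.byz ∧ ∀ t, ¬ (e.state t p).dead

/-- The (non-Byzantine) process `i` broadcasts `v` in round `r`: it wants to, and is not in the
Dead-State. -/
def Broadcasts (e : Run n f V) (i : Fin n) (v : V) (r : ℕ) : Prop :=
  e.request i = some (r, v) ∧ ¬ (e.state r i).dead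

/-- The process `p` delivers `v`, with sender `i`, in round `t`. -/
def Delivers (e : Run n f V) (p i : Fin n) (v : V) (t : ℕ) : Prop :=
  (e.state t p).dlv i = none ∧ ∃ d, (e.state (t + 1) p).dlv i = some d ∧ d.msg.value = v

end Run

end RTByzCast

/-! ### The broadcast abstraction

For processes `P` and values `V`: `correct p`; `broadcasts i v r`, `i` broadcasts `v` at time `r`;
`delivers p i v t`, `p` delivers `v` with sender `i` at time `t`. -/

namespace RTBRB

variable {P V : Type*}

/-- If a correct process broadcasts `v`, then some correct process eventually delivers `v`. -/
def Validity (correct : P → Prop) (broadcasts : P → V → ℕ → Prop)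
    (delivers : P → P → V → ℕ → Prop) : Prop :=
  ∀ i v r, correct i → broadcasts i v r → ∃ p t, correct p ∧ r ≤ t ∧ delivers p i v t

/-- Every correct process delivers at most one message of each sender, at most once. -/
def NoDuplication (correct : P → Prop) (delivers : P → P → V → ℕ → Prop) : Prop :=
  ∀ p i v v' t t', correct p → delivers p i v t → delivers p i v' t' → v = v' ∧ t = t'

/-- If a correct process delivers `v` with a correct sender `i`, then `i` previously broadcast
`v`. -/
def Integrity (correct : P → Prop) (broadcasts : P → V → ℕ → Prop)
    (delivers : P → P → V → ℕ → Prop) : Prop :=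
  ∀ p i v t, correct p → correct i → delivers p i v t → ∃ r ≤ t, broadcasts i v r

/-- If a correct process delivers `v` with sender `i`, correct or not, then every correct process
eventually delivers `v` with sender `i`. -/
def Agreement (correct : P → Prop) (delivers : P → P → V → ℕ → Prop) : Prop :=
  ∀ p q i v t, correct p → correct q → delivers p i v t → ∃ t', delivers q i v t'

/-- If a correct process broadcasts `v` at time `r`, then no correct process delivers `v` after time
`r + Δ`. -/
def Timeliness (Δ : ℕ) (correct : P → Prop) (broadcasts : P → V → ℕ → Prop)
    (delivers : P → P → V → ℕ → Prop) : Prop :=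
  ∀ i v r p t, correct i → broadcasts i v r → correct p → delivers p i v t → t ≤ r + Δ

end RTBRB

/-! Safety is quorum intersection. Among `3 * f + 1` processes, two sets of `2 * f + 1` share a
non-Byzantine one, and that one echoes a single payload of each sender. Tracing signatures back to
their makers (`genuine`) turns membership in a certificate into an actual echo, so non-Byzantine
processes deliver the same payload of a given sender (`msg_unique`). In the same way, what is
delivered from a non-Byzantine sender was broadcast by it.

Liveness holds although any message may be lost, because survival is itself evidence of
communication. A broadcaster that escapes the echo rule has a certificate after `R` rounds
(`broadcaster_delivers`). A process that escapes the heartbeat rule holds signatures of a quorum on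
its recent heartbeats; such a signature by another non-Byzantine process attests traffic in both
directions, and heartbeats cannot be separated from the messages they ride on. If `p` delivers in
round `r`, the quorum for its heartbeats from round `r + 1` on and the quorum of a survivor `q` for
those from round `r + R` on share a non-Byzantine `x`, through which the delivery spreads from `p`
to `q` by round `r + 2 * R` (`all_deliver`). This gives Agreement and, after the first `R` rounds,
the bound `3 * R`. -/

namespace RTByzCast

/-! ### Signatures inside a single message -/

section Signatures

variable {n f : ℕ} {V : Type*}

theorem SignedIn.mono {M M' : Set (Sig n f V)} (h : M ⊆ M') {x : Fin n} {a : Act n f V}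
    (hs : SignedIn M x a) : SignedIn M' x a := by
  induction hs with
  | direct h1 => exact .direct (h h1)
  | carrier h1 h2 => exact .carrier (h h1) h2
  | cert _ h2 ih => exact .cert ih h2
  | origin _ ih => exact .origin ih

/-- Nesting never combines several transmitted signatures, so knowledge gathered over many rounds
can be located on one link in one round. -/
theorem SignedIn.exists_singleton {M : Set (Sig n f V)} {x : Fin n} {a : Act n f V}
    (hs : SignedIn M x a) : ∃ σ ∈ M, SignedIn {σ} x a := by
  induction hs with
  | direct h1 => exact ⟨_, h1, .direct rfl⟩
  | carrier h1 h2 => exact ⟨_, h1, .carrier rfl h2⟩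
  | cert _ h2 ih => obtain ⟨σ, h, h'⟩ := ih; exact ⟨σ, h, .cert h' h2⟩
  | origin _ ih => obtain ⟨σ, h, h'⟩ := ih; exact ⟨σ, h, .origin h'⟩

theorem SignedIn.exists_link {I : Inbox n f V} {t : ℕ} {x : Fin n} {a : Act n f V}
    (hs : SignedIn (I.before t) x a) : ∃ t' < t, ∃ p, SignedIn (I t' p) x a := by
  obtain ⟨σ, ⟨t', ht', p, hp⟩, h⟩ := hs.exists_singleton
  exact ⟨t', ht', p, h.mono (by simpa using hp)⟩

theorem Inbox.before_mono (I : Inbox n f V) {t t' : ℕ} (h : t ≤ t') : I.before t ⊆ I.before t' :=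
  fun _ ⟨u, hu, hσ⟩ => ⟨u, hu.trans_le h, hσ⟩

theorem Inbox.during_subset_before (I : Inbox n f V) (t : ℕ) : I.during t ⊆ I.before (t + 1) :=
  fun _ hσ => ⟨t, t.lt_succ_self, hσ⟩

theorem Inbox.link_subset_during (I : Inbox n f V) (t : ℕ) (p : Fin n) : I t p ⊆ I.during t :=
  fun _ hσ => ⟨p, hσ⟩

/-- Of what is echoed and delivered, a process has received the signatures, except possibly its own
signature on its echo. -/
structure LState.Justified (j : Fin n) (s : LState n f V) (K : Set (Sig n f V)) : Prop where
  echo : ∀ i m r, s.echo i = some (m, r) → SignedIn K i (.bcast m)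
  dlv : ∀ i d, s.dlv i = some d → ∀ x ∈ d.cert.1,
    SignedIn K x (.echo d.via i d.msg) ∨ (x = j ∧ ∃ r, s.echo i = some (d.msg, r))

theorem LState.Justified.mono {j : Fin n} {s : LState n f V} {K K' : Set (Sig n f V)}
    (h : s.Justified j K) (hK : K ⊆ K') : s.Justified j K' :=
  ⟨fun i m r e => (h.echo i m r e).mono hK,
    fun i d e x hx => (h.dlv i d e x hx).imp (·.mono hK) id⟩

theorem LState.Justified.signedIn_bcast {j : Fin n} {s : LState n f V} {K : Set (Sig n f V)}
    (h : s.Justified j K) {i : Fin n} {d : Delivery n f V} (hd : s.dlv i = some d) :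
    SignedIn K i (.bcast d.msg) := by
  obtain ⟨x, hx⟩ : d.cert.1.Nonempty := Finset.card_pos.1 (by have := d.cert.2; omega)
  rcases h.dlv i d hd x hx with h1 | ⟨-, r, h1⟩
  · exact .origin h1
  · exact h.echo i _ r h1

theorem LState.Justified.step {R : ℕ} {j : Fin n} {req : Option (ℕ × V)} {I : Inbox n f V} {t : ℕ}
    {s s' : LState n f V} (h : s.Justified j (I.before t)) (hs : Step R j req I t s s') :
    s'.Justified j (I.before (t + 1)) := by
  have hm := h.mono (I.before_mono t.le_succ)
  by_cases hdead : s.dead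
  · rwa [hs.dead hdead]
  refine ⟨fun i m r e => ?_, fun i d e x hx => ?_⟩
  · by_cases hk : s.dlv i ≠ none ∨ s.echo i ≠ none
    · exact hm.echo i m r (hs.echo_kept hdead i hk ▸ e)
    · push Not at hk
      rcases hs.echo_new hdead i hk.1 hk.2 with ⟨m', hh, e'⟩ | ⟨-, e'⟩
      · obtain ⟨rfl, -⟩ : m' = m ∧ t + 1 = r := by simpa [e'] using e
        refine SignedIn.mono (I.during_subset_before t) ?_
        rcases hh with ⟨hh, -⟩ | ⟨y, k, hh⟩
        · exact hh
        · exact .origin hh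
      · simp [e'] at e
  · by_cases hk : s.dlv i = none
    · rcases hs.dlv_new hdead i hk with ⟨d', ⟨-, hc⟩, e'⟩ | ⟨-, e'⟩
      · obtain rfl : d' = d := by simpa [e'] using e
        rcases hc with ⟨r, hr, hc⟩ | ⟨y, hy⟩
        · have hx' : x ∈ (d'.cert.1 : Set (Fin n)) := hx
          rw [hc] at hx'
          rcases hx' with rfl | hx'
          · exact Or.inr ⟨rfl, r, hr⟩
          · exact Or.inl hx'
        · exact Or.inl ((SignedIn.cert hy hx).mono (I.during_subset_before t))
      · simp [e'] at e
    · rw [hs.dlv_kept hdead i hk] at e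
      -- A delivery freezes the echo as well, so the alternative about the own echo persists.
      rw [hs.echo_kept hdead i (Or.inl hk)]
      exact hm.dlv i d e x hx

/-- The process signs `a` in its message, or `a` is an echo of the broadcast that it echoes. -/
def Genuine (j : Fin n) (req : Option (ℕ × V)) (t : ℕ) (s : LState n f V) (K : Set (Sig n f V))
    (a : Act n f V) : Prop :=
  a ∈ acts j req t s K ∨ ∃ k i m r, a = .echo k i m ∧ s.echo i = some (m, r)

/-- A message consists of relayed signatures and fresh ones. The delicate case is a certificate:
`aggregate` counts `j` even if `j` never sent that echo, so its signature may first appear inside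
its own `Deliver`. The second alternative of `Genuine` accounts for this. -/
theorem signedIn_message {R : ℕ} {j : Fin n} {req : Option (ℕ × V)} {t : ℕ} {s : LState n f V}
    {K : Set (Sig n f V)} (hJ : s.Justified j K) {x : Fin n} {a : Act n f V}
    (h : SignedIn (message R j req t s K) x a) :
    SignedIn K x a ∨ (x = j ∧ Genuine j req t s K a) := by
  induction h with
  | direct h =>
    rcases h.2 with h | h
    · cases h with
      | act h => exact Or.inr ⟨rfl, Or.inl h⟩
    · cases h with
      | echo => exact Or.inl (by assumption)
      | deliver => exact Or.inl (by assumption)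
  | carrier h ha =>
    rcases h.2 with h | h
    · cases h with
      | heartbeat => exact Or.inr ⟨rfl, Or.inl ha⟩
      | relay _ _ => exact Or.inr ⟨rfl, Or.inl ha⟩
    · cases h with
      | heartbeat _ h _ => exact Or.inl (.carrier h ha)
  | cert _ hx ih =>
    rcases ih with ih | ⟨rfl, ih | ⟨_, _, _, _, ih, -⟩⟩
    · exact Or.inl (.cert ih hx)
    · cases ih with
      | deliver hd _ =>
        rcases hJ.dlv _ _ hd _ hx with h | ⟨h, r, hr⟩
        · exact Or.inl h
        · exact Or.inr ⟨h, Or.inr ⟨_, _, _, _, rfl, hr⟩⟩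
    · cases ih
  | origin _ ih =>
    rcases ih with ih | ⟨rfl, ih | ⟨_, _, _, _, ih, hr⟩⟩
    · exact Or.inl (.origin ih)
    · cases ih with
      | echo _ hr _ => exact Or.inl (hJ.echo _ _ _ hr)
    · cases ih
      exact Or.inl (hJ.echo _ _ _ hr)

end Signatures

/-- The intersection has at least `2 * (2 * f + 1) - (3 * f + 1) = f + 1` elements. -/
theorem exists_mem_inter_notMem {n f : ℕ} (hn : n = 3 * f + 1) {B S T : Finset (Fin n)}
    (hB : B.card ≤ f) (hS : 2 * f + 1 ≤ S.card) (hT : 2 * f + 1 ≤ T.card) :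
    ∃ x ∈ S, x ∈ T ∧ x ∉ B := by
  have h1 := Finset.card_union_add_card_inter S T
  have h2 : (S ∪ T).card ≤ n := by simpa using Finset.card_le_univ (S ∪ T)
  obtain ⟨x, hx, hxB⟩ := Finset.exists_mem_notMem_of_card_lt_card (s := B) (t := S ∩ T) (by omega)
  rw [Finset.mem_inter] at hx
  exact ⟨x, hx.1, hx.2, hxB⟩

namespace Run.IsExecution

variable {n f R : ℕ} {V : Type*} {e : Run n f V}

/-! ### Evolution of the local states -/

section State

theorem dead_mono (he : e.IsExecution R) {p : Fin n} (hp : p ∉ e.byz) {t t' : ℕ} (h : t ≤ t')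
    (hd : (e.state t p).dead) : (e.state t' p).dead := by
  induction h with
  | refl => exact hd
  | step _ ih => rw [(he.step _ p hp).dead ih]; exact ih

theorem echo_mono (he : e.IsExecution R) {p : Fin n} (hp : p ∉ e.byz) {i : Fin n} {t t' : ℕ}
    (h : t ≤ t') {x : Payload V × ℕ} (hx : (e.state t p).echo i = some x) :
    (e.state t' p).echo i = some x := by
  induction h with
  | refl => exact hx
  | @step u _ ih =>
    by_cases hd : (e.state u p).dead
    · rwa [(he.step _ p hp).dead hd]
    · rwa [(he.step _ p hp).echo_kept hd i (Or.inr (by simp [ih]))]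

theorem dlv_mono (he : e.IsExecution R) {p : Fin n} (hp : p ∉ e.byz) {i : Fin n} {t t' : ℕ}
    (h : t ≤ t') {d : Delivery n f V} (hd : (e.state t p).dlv i = some d) :
    (e.state t' p).dlv i = some d := by
  induction h with
  | refl => exact hd
  | @step u _ ih =>
    by_cases hd : (e.state u p).dead
    · rwa [(he.step _ p hp).dead hd]
    · rwa [(he.step _ p hp).dlv_kept hd i (by simp [ih])]

/-- A restart in a round `u ≥ t` sets the limit to `u + 1 + 2 * R`, so under `hb` it cannot fall
below `b`. -/
theorem le_sendUntil (he : e.IsExecution R) {p : Fin n} (hp : p ∉ e.byz) {i : Fin n} {b t t' : ℕ}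
    (hb : b ≤ t + 1 + 2 * R) (h : t ≤ t') (hs : b ≤ (e.state t p).sendUntil i) :
    b ≤ (e.state t' p).sendUntil i := by
  induction h with
  | refl => exact hs
  | @step u hu ih =>
    by_cases hd : (e.state u p).dead
    · rwa [(he.step _ p hp).dead hd]
    · by_cases hc : (e.state (u + 1) p).dlv i ≠ none ∧ ((e.state u p).dlv i = none ∨
          ∃ q ≠ p, ∃ y m k S, SignedIn (e.inbox p u q) y (.deliver i m k S))
      · rw [(he.step _ p hp).send_set hd i hc.1 hc.2]
        have : t ≤ u := hu
        omega
      · rwa [(he.step _ p hp).send_kept hd i hc]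

theorem justified (he : e.IsExecution R) {p : Fin n} (hp : p ∉ e.byz) (t : ℕ) :
    (e.state t p).Justified p ((e.inbox p).before t) := by
  induction t with
  | zero =>
    rw [he.init p hp]
    exact ⟨fun _ _ _ h => by simp [LState.initial] at h, fun _ _ h => by simp [LState.initial] at h⟩
  | succ t ih => exact ih.step (he.step t p hp)

theorem not_crash (he : e.IsExecution R) {p : Fin n} (hp : p ∉ e.byz) {t : ℕ}
    (h : ¬ (e.state (t + 1) p).dead) :
    ¬ Crash R p (e.request p) (e.inbox p) t (e.state (t + 1) p) := fun hc =>
  h (((he.step t p hp).crash fun hd => h (he.dead_mono hp t.le_succ hd)).2 hc)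

theorem not_dead_of_correctThrough (he : e.IsExecution R) {p : Fin n} {t t' : ℕ}
    (h : e.CorrectThrough t p) (ht : t' ≤ t + 1) : ¬ (e.state t' p).dead := fun hd =>
  h.2 t le_rfl (he.dead_mono h.1 ht hd)

theorem exists_delivery (he : e.IsExecution R) {p : Fin n} (hp : p ∉ e.byz) {i : Fin n} {t : ℕ}
    (h : (e.state t p).dlv i ≠ none) :
    ∃ u < t, (e.state u p).dlv i = none ∧ ∃ d, (e.state (u + 1) p).dlv i = some d := by
  induction t with
  | zero => rw [he.init p hp] at h; simp [LState.initial] at h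
  | succ t ih =>
    by_cases h0 : (e.state t p).dlv i = none
    · exact ⟨t, t.lt_succ_self, h0, Option.ne_none_iff_exists'.1 h⟩
    · obtain ⟨u, hu, h'⟩ := ih h0
      exact ⟨u, hu.trans t.lt_succ_self, h'⟩

theorem lt_of_delivers (he : e.IsExecution R) {p : Fin n} (hp : p ∉ e.byz) {i : Fin n} {t t' : ℕ}
    (h : (e.state t p).dlv i = none) {d : Delivery n f V}
    (h' : (e.state t' p).dlv i = some d) : t < t' := by
  by_contra hle
  simp [he.dlv_mono hp (not_lt.1 hle) h'] at h

theorem dlv_ne_none_of_canDeliver (he : e.IsExecution R) {p : Fin n} (hp : p ∉ e.byz) {i : Fin n}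
    {t : ℕ} (ht : ¬ (e.state t p).dead) {d : Delivery n f V}
    (h : CanDeliver p (e.inbox p) t (e.state (t + 1) p) i d) :
    (e.state (t + 1) p).dlv i ≠ none := by
  by_cases h0 : (e.state t p).dlv i = none
  · rcases (he.step t p hp).dlv_new ht i h0 with ⟨d', -, h'⟩ | ⟨h', -⟩
    · simp [h']
    · exact absurd h (h' d)
  · rwa [(he.step t p hp).dlv_kept ht i h0]

theorem dlv_ne_none_of_signedIn (he : e.IsExecution R) {p : Fin n} (hp : p ∉ e.byz) {i : Fin n}
    {t : ℕ} (ht : ¬ (e.state t p).dead) {q y k : Fin n} {m : Payload V} {S : Quorum n f}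
    (h : SignedIn (e.inbox p t q) y (.deliver i m k S)) :
    (e.state (t + 1) p).dlv i ≠ none :=
  he.dlv_ne_none_of_canDeliver hp ht (d := ⟨m, k, S, t⟩)
    ⟨rfl, Or.inr ⟨y, h.mono (Inbox.link_subset_during _ _ _)⟩⟩

end State

/-! ### Provenance of signatures and uniqueness of payloads -/

section Signatures

theorem link_cases (he : e.IsExecution R) {p q : Fin n} (hp : p ∉ e.byz) (hq : q ∉ e.byz) (t : ℕ) :
    e.inbox q t p = e.sent R t p ∨ e.inbox q t p = ∅ := by
  by_cases hpq : p = q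
  · subst hpq; exact Or.inl (he.link_self t p hp)
  · exact he.link t p hp q hq hpq

/-- Whatever a non-Byzantine process appears to have signed, it has signed. -/
theorem genuine (he : e.IsExecution R) {q x : Fin n} (hq : q ∉ e.byz) (hx : x ∉ e.byz) {t : ℕ}
    {p : Fin n} {a : Act n f V} (h : SignedIn (e.inbox q t p) x a) :
    ∃ t' ≤ t, ¬ (e.state t' x).dead ∧
      Genuine x (e.request x) t' (e.state t' x) ((e.inbox x).before t') a := by
  induction t using Nat.strong_induction_on generalizing q p with
  | _ t ih =>
    -- A Byzantine process may replay a signature in the very round in which it is made, so round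
    -- `t` itself must be covered. What is sent in round `t'` depends only on earlier inboxes, to
    -- which the induction hypothesis applies.
    have key : ∀ t' ≤ t, ∀ p ∉ e.byz, SignedIn (e.sent R t' p) x a →
        ∃ t' ≤ t, ¬ (e.state t' x).dead ∧
          Genuine x (e.request x) t' (e.state t' x) ((e.inbox x).before t') a := by
      intro t' ht' p hp h
      rcases signedIn_message (he.justified hp t') h with h1 | ⟨rfl, h1⟩
      · obtain ⟨u, hu, p', h2⟩ := h1.exists_link
        obtain ⟨u', hu', h3⟩ := ih u (hu.trans_le ht') hp h2
        exact ⟨u', by omega, h3⟩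
      · obtain ⟨σ, hσ, -⟩ := h.exists_singleton
        exact ⟨t', ht', hσ.1, h1⟩
    by_cases hp : p ∈ e.byz
    · obtain ⟨t', ht', h'⟩ := (he.unforgeable t p hp q hq x hx).2 a h
      have hsub : e.signed R t' x ⊆ e.sent R t' x := fun σ hσ => ⟨hσ.1, Or.inl hσ.2⟩
      exact key t' ht' x hx (h'.mono hsub)
    · rcases he.link_cases hp hq t with h1 | h1 <;> rw [h1] at h
      · exact key t le_rfl p hp h
      · obtain ⟨σ, hσ, -⟩ := h.exists_singleton
        exact hσ.elim

theorem signed_of_hb_mem (he : e.IsExecution R) {q x : Fin n} (hq : q ∉ e.byz) (hx : x ∉ e.byz)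
    {t : ℕ} {p i : Fin n} {h : ℕ} {c : Set (Act n f V)} (hσ : Sig.hb x i h c ∈ e.inbox q t p) :
    ∃ t' ≤ t, Sig.hb x i h c ∈ e.signed R t' x := by
  induction t using Nat.strong_induction_on generalizing q p with
  | _ t ih =>
    by_cases hp : p ∈ e.byz
    · exact (he.unforgeable t p hp q hq x hx).1 i h c hσ
    · rcases he.link_cases hp hq t with h1 | h1 <;> rw [h1] at hσ
      · rcases hσ with ⟨hd, hσ | hσ⟩
        · obtain rfl : x = p := by cases hσ <;> rfl
          exact ⟨t, le_rfl, hd, hσ⟩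
        · cases hσ with
          | heartbeat _ h2 _ =>
            obtain ⟨u, hu, p', h3⟩ := h2
            obtain ⟨u', hu', h4⟩ := ih u hu hp h3
            exact ⟨u', by omega, h4⟩
      · exact hσ.elim

/-- The heartbeat `{p, h}` signed by `p` is signed in round `h` or later, with the messages of `p` in
that round as its carrier. -/
theorem own_hb (he : e.IsExecution R) {q p : Fin n} (hq : q ∉ e.byz) (hp : p ∉ e.byz) {t : ℕ}
    {y : Fin n} {h : ℕ} {c : Set (Act n f V)} (hσ : Sig.hb p p h c ∈ e.inbox q t y) :
    ∃ t' ≤ t, h ≤ t' ∧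
      c = acts p (e.request p) t' (e.state t' p) ((e.inbox p).before t') := by
  induction t using Nat.strong_induction_on generalizing q y c with
  | _ t ih =>
    obtain ⟨t', ht', -, h1⟩ := he.signed_of_hb_mem hq hp hσ
    cases h1 with
    | heartbeat => exact ⟨_, ht', le_rfl, rfl⟩
    -- A process also relays its own heartbeat, with the messages of that later round as carrier.
    | relay h2 _ =>
      obtain ⟨u, hu, y', h3⟩ := h2
      obtain ⟨u', hu', h4, -⟩ := ih u (hu.trans_le ht') hp h3
      exact ⟨t', ht', by omega, rfl⟩

/-- Another process that signs `{p, h}` has received it before. -/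
theorem relayed_hb (he : e.IsExecution R) {q x p : Fin n} (hq : q ∉ e.byz) (hx : x ∉ e.byz)
    (hxp : x ≠ p) {t : ℕ} {y : Fin n} {h : ℕ} {c : Set (Act n f V)}
    (hσ : Sig.hb x p h c ∈ e.inbox q t y) :
    ∃ t' ≤ t, ¬ (e.state t' x).dead ∧
      c = acts x (e.request x) t' (e.state t' x) ((e.inbox x).before t') ∧
      ∃ c', Sig.hb p p h c' ∈ (e.inbox x).before t' := by
  obtain ⟨t', ht', hd, h1⟩ := he.signed_of_hb_mem hq hx hσ
  cases h1 with
  | heartbeat => exact absurd rfl hxp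
  | relay h2 _ => exact ⟨t', ht', hd, rfl, _, h2⟩

/-- The signature of another process on a heartbeat is first received from another process. -/
theorem hb_from_other (he : e.IsExecution R) {x p i : Fin n} (hx : x ∉ e.byz) (hxp : x ≠ p)
    {t : ℕ} {h : ℕ} {c : Set (Act n f V)} (hσ : Sig.hb p i h c ∈ (e.inbox x).before t) :
    ∃ t' < t, ∃ y ≠ x, Sig.hb p i h c ∈ e.inbox x t' y := by
  induction t using Nat.strong_induction_on with
  | _ t ih =>
    obtain ⟨u, hu, y, h1⟩ := hσ
    by_cases hy : y = x
    · subst hy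
      rw [he.link_self u y hx] at h1
      rcases h1.2 with h1 | h1
      · cases h1 <;> exact absurd rfl hxp
      · cases h1 with
        | heartbeat _ h2 _ =>
          obtain ⟨u', hu', h3⟩ := ih u hu h2
          exact ⟨u', hu'.trans hu, h3⟩
    · exact ⟨u, hu, y, hy, h1⟩

theorem exists_echo_of_mem_cert (he : e.IsExecution R) {p x : Fin n} (hp : p ∉ e.byz)
    (hx : x ∉ e.byz) {i : Fin n} {t : ℕ} {d : Delivery n f V} (hd : (e.state t p).dlv i = some d)
    (hxd : x ∈ d.cert.1) : ∃ t' r, (e.state t' x).echo i = some (d.msg, r) := by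
  rcases (he.justified hp t).dlv i d hd x hxd with h | ⟨rfl, r, hr⟩
  · obtain ⟨u, -, y, h1⟩ := h.exists_link
    obtain ⟨u', -, -, h2 | ⟨k, i', m, r, h2, hr⟩⟩ := he.genuine hp hx h1
    · cases h2 with
      | echo _ hr _ => exact ⟨u', _, hr⟩
    · cases h2
      exact ⟨u', r, hr⟩
  · exact ⟨t, r, hr⟩

theorem msg_unique (he : e.IsExecution R) (hn : n = 3 * f + 1) (hbyz : e.byz.card ≤ f)
    {p q i : Fin n} (hp : p ∉ e.byz) (hq : q ∉ e.byz) {t t' : ℕ} {d d' : Delivery n f V}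
    (hd : (e.state t p).dlv i = some d) (hd' : (e.state t' q).dlv i = some d') :
    d.msg = d'.msg := by
  obtain ⟨x, h1, h2, hx⟩ := exists_mem_inter_notMem hn hbyz d.cert.2 d'.cert.2
  obtain ⟨u, r, h3⟩ := he.exists_echo_of_mem_cert hp hx hd h1
  obtain ⟨u', r', h4⟩ := he.exists_echo_of_mem_cert hq hx hd' h2
  have h5 := he.echo_mono hx (le_max_left u u') h3
  rw [he.echo_mono hx (le_max_right u u') h4] at h5
  simp only [Option.some.injEq, Prod.mk.injEq] at h5
  exact h5.1.symm

/-- The signature traces back to a round in which `i`, still alive, was sending its request. Besides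
Integrity, this excludes a discovered lie of a non-Byzantine sender and bounds the round of delivery
from below. -/
theorem broadcasts_of_signedIn (he : e.IsExecution R) {p i : Fin n} (hp : p ∉ e.byz)
    (hi : i ∉ e.byz) {t : ℕ} {m : Payload V}
    (h : SignedIn ((e.inbox p).before (t + 1)) i (.bcast m)) :
    m.round ≤ t ∧ e.Broadcasts i m.value m.round := by
  obtain ⟨u, hu, y, h1⟩ := h.exists_link
  obtain ⟨u', hu', hd, h2 | ⟨_, _, _, _, h2, -⟩⟩ := he.genuine hp hi h1
  · cases h2 with
    | @bcast r v hreq hr _ =>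
      have hru : r ≤ t := by omega
      exact ⟨hru, hreq, fun h => hd (he.dead_mono hi hr h)⟩
  · cases h2

theorem broadcasts_of_dlv (he : e.IsExecution R) {p i : Fin n} (hp : p ∉ e.byz)
    (hi : i ∉ e.byz) {t : ℕ} {d : Delivery n f V} (h : (e.state (t + 1) p).dlv i = some d) :
    d.msg.round ≤ t ∧ e.Broadcasts i d.msg.value d.msg.round :=
  he.broadcasts_of_signedIn hp hi ((he.justified hp (t + 1)).signedIn_bcast h)

end Signatures

/-! ### Survival forces delivery -/

section Liveness

/-- A broadcasting process that survives delivers its own broadcast within `R` rounds. -/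
theorem broadcaster_delivers (he : e.IsExecution R) {i : Fin n} (hi : i ∉ e.byz) {r : ℕ} {v : V}
    (hb : e.request i = some (r, v)) (ha : ¬ (e.state (r + R + 1) i).dead) :
    (e.state (r + R + 1) i).dlv i ≠ none := by
  intro h0
  have hc : ¬ CrashEcho R i (e.request i) (e.inbox i) (r + R) (e.state (r + R + 1) i) :=
    fun h => he.not_crash hi ha (Or.inl h)
  refine hc ⟨i, r, Or.inl ⟨rfl, by omega, v, hb⟩, fun w => ?_, le_rfl, ?_⟩
  · by_contra hlt
    rw [not_le] at hlt
    obtain ⟨y, hy⟩ := Set.nonempty_of_ncard_ne_zero (by omega : (echoSet i i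
      (e.state (r + R + 1) i) ((e.inbox i).before (r + R + 1)) w).ncard ≠ 0)
    rcases hy with ⟨d, hd, -⟩ | ⟨-, m, r', hm, hmv, -⟩
    · simp [h0] at hd
    -- As nothing is delivered, all these signers are on the own echo of `m`; being more than `2 *
    -- f`, they form a certificate that forces a delivery in round `r + R`.
    · have hsub : echoSet i i (e.state (r + R + 1) i) ((e.inbox i).before (r + R + 1)) w ⊆
          aggregate i i i m ((e.inbox i).before (r + R + 1)) := by
        rintro z (⟨d, hd, -⟩ | ⟨-, m', r'', hm', -, hz⟩)
        · simp [h0] at hd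
        · rw [hm] at hm'
          cases hm'
          exact hz
      have hcard := hlt.trans_le (Set.ncard_le_ncard hsub (Set.toFinite _))
      classical
      rw [Set.ncard_eq_toFinset_card'] at hcard
      exact he.dlv_ne_none_of_canDeliver hi (fun h => ha (he.dead_mono hi (Nat.le_succ _) h))
        (d := ⟨m, i, ⟨_, hcard⟩, r + R⟩) ⟨rfl, Or.inl ⟨r', hm, by simp⟩⟩ h0
  · rintro ⟨m, m', hne, hm, hm'⟩
    have h1 := (he.broadcasts_of_signedIn hi hi hm).2.1
    have h2 := (he.broadcasts_of_signedIn hi hi hm').2.1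
    rw [h1] at h2
    simp only [Option.some.injEq, Prod.mk.injEq] at h2
    exact hne h2.2

/-- This is the heartbeat rule not firing at the end of round `t + R`, whose window starts in round
`t`. -/
theorem exists_quorum_hb (he : e.IsExecution R) {p : Fin n} (hp : p ∉ e.byz) {t : ℕ}
    (ha : ¬ (e.state (t + R + 1) p).dead) :
    ∃ S : Finset (Fin n), 2 * f + 1 ≤ S.card ∧ ∀ x ∈ S, ∃ h c u y,
      t ≤ h ∧ u ≤ t + R ∧ Sig.hb x p h c ∈ e.inbox p u y := by
  classical
  have hc : ¬ CrashHeartbeat R p (e.inbox p) (t + R) :=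
    fun h => he.not_crash hp ha (Or.inr (Or.inr (Or.inr h)))
  have hlt := not_le.1 fun h => hc ⟨by omega, h⟩
  rw [Set.ncard_eq_toFinset_card'] at hlt
  refine ⟨_, hlt, fun x hx => ?_⟩
  obtain ⟨h, c, h1, -, u, hu, y, hy⟩ := Set.mem_toFinset.1 hx
  exact ⟨h, c, u, y, by omega, by omega, hy⟩

theorem sends_after_delivery (he : e.IsExecution R) {p i : Fin n} (hp : p ∉ e.byz) {r : ℕ}
    {d : Delivery n f V} (h0 : (e.state r p).dlv i = none)
    (h1 : (e.state (r + 1) p).dlv i = some d) {t : ℕ} (ht : r + 1 ≤ t) :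
    (e.state t p).dlv i = some d ∧ r + 1 + 2 * R ≤ (e.state t p).sendUntil i := by
  refine ⟨he.dlv_mono hp ht h1, he.le_sendUntil hp (by omega) ht ?_⟩
  by_cases hd : (e.state r p).dead
  · rw [(he.step r p hp).dead hd, h0] at h1
    cases h1
  · rw [(he.step r p hp).send_set hd i (by simp [h1]) (Or.inl h0)]

/-- Even if `x` delivered long ago and has fallen silent, the receipt restarts its sending period.
Its own messages would not, hence `hq`. -/
theorem sends_after_receipt (he : e.IsExecution R) {x : Fin n} (hx : x ∉ e.byz) {u : ℕ}
    (hu : ¬ (e.state u x).dead) {i q y k : Fin n} (hq : q ≠ x) {m : Payload V} {S : Quorum n f}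
    (h : SignedIn (e.inbox x u q) y (.deliver i m k S)) {t : ℕ} (ht : u + 1 ≤ t) :
    (∃ d, (e.state t x).dlv i = some d) ∧ u + 1 + 2 * R ≤ (e.state t x).sendUntil i := by
  have h1 := he.dlv_ne_none_of_signedIn hx hu h
  obtain ⟨d, hd⟩ := Option.ne_none_iff_exists'.1 h1
  refine ⟨⟨d, he.dlv_mono hx ht hd⟩, he.le_sendUntil hx (by omega) ht ?_⟩
  rw [(he.step u x hx).send_set hu i h1 (Or.inr ⟨q, hq, y, m, k, S, h⟩)]

/-- When a process delivers in round `r` and survives, every process that survives delivers by round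
`r + 2 R`. -/
theorem all_deliver (he : e.IsExecution R) (hn : n = 3 * f + 1) (hbyz : e.byz.card ≤ f)
    {p q i : Fin n} (hp : p ∉ e.byz) (hq : q ∉ e.byz) {r : ℕ} {d : Delivery n f V}
    (h0 : (e.state r p).dlv i = none) (h1 : (e.state (r + 1) p).dlv i = some d)
    (hap : ¬ (e.state (r + R + 2) p).dead) (haq : ¬ (e.state (r + 2 * R + 1) q).dead) :
    (e.state (r + 2 * R + 1) q).dlv i ≠ none := by
  -- Heartbeats of `p` issued from round `r + 1` on ride on its `Deliver` message.
  obtain ⟨S, hS, hSm⟩ := he.exists_quorum_hb hp (t := r + 1)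
    (by rwa [show r + 1 + R + 1 = r + R + 2 by omega])
  -- If `x` differs from `p` and `q`, it has heard `p` by round `r + R`, and it signs a heartbeat of
  -- `q` issued in round `r + R` or later only in rounds `r + R + 1, …, r + 2 * R`, while it is
  -- sending `Deliver`.
  obtain ⟨T, hT, hTm⟩ := he.exists_quorum_hb hq (t := r + R)
    (by rwa [show r + R + R + 1 = r + 2 * R + 1 by omega])
  obtain ⟨x, hxS, hxT, hx⟩ := exists_mem_inter_notMem hn hbyz hS hT
  have sends : ∀ t, r + R + 1 ≤ t →
      (∃ d, (e.state t x).dlv i = some d) ∧ r + 1 + 2 * R ≤ (e.state t x).sendUntil i := by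
    intro t ht
    by_cases hxp : x = p
    · subst hxp
      have := he.sends_after_delivery hx h0 h1 (t := t) (by omega)
      exact ⟨⟨d, this.1⟩, this.2⟩
    obtain ⟨h, c, u, y, hh, hu, hσ⟩ := hSm x hxS
    obtain ⟨u1, hu1, hd1, -, c', hc'⟩ := he.relayed_hb hp hx hxp hσ
    obtain ⟨u2, hu2, z, hz, hσ'⟩ := he.hb_from_other hx hxp hc'
    obtain ⟨u3, hu3, hh3, rfl⟩ := he.own_hb hx hp hσ'
    obtain ⟨hd3, hs3⟩ := he.sends_after_delivery hp h0 h1 (t := u3) (by omega)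
    -- The rounds satisfy `r + 1 ≤ h ≤ u3 ≤ u2 < u1 ≤ u ≤ r + 1 + R`, so `p` is still sending in
    -- round `u3`.
    have hact := acts.deliver (j := p) (req := e.request p) (t := u3)
      (K := (e.inbox p).before u3) hd3 (by omega)
    have := he.sends_after_receipt hx (fun h => hd1 (he.dead_mono hx hu2.le h)) hz
      (SignedIn.carrier hσ' hact) (t := t) (by omega)
    exact ⟨this.1, by omega⟩
  by_cases hxq : x = q
  · subst hxq
    obtain ⟨d', hd'⟩ := (sends (r + 2 * R + 1) (by omega)).1
    simp [hd']
  obtain ⟨h, c, u, y, hh, hu, hσ⟩ := hTm x hxT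
  obtain ⟨u1, hu1, -, rfl, c', u2, hu2, z, hσ'⟩ := he.relayed_hb hq hx hxq hσ
  obtain ⟨u3, hu3, hh3, -⟩ := he.own_hb hx hq hσ'
  obtain ⟨⟨d', hd'⟩, hs'⟩ := sends u1 (by omega)
  have hact := acts.deliver (j := x) (req := e.request x) (t := u1)
    (K := (e.inbox x).before u1) hd' (by omega)
  obtain ⟨d'', hd''⟩ := Option.ne_none_iff_exists'.1 (he.dlv_ne_none_of_signedIn hq
    (fun h => haq (he.dead_mono hq (by omega) h)) (SignedIn.carrier hσ hact))
  simp [he.dlv_mono hq (by omega : u + 1 ≤ r + 2 * R + 1) hd'']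

end Liveness

/-! ### The broadcast properties -/

theorem delivers_unique (he : e.IsExecution R) {p i : Fin n} (hp : p ∉ e.byz) {v v' : V}
    {t t' : ℕ} (h : e.Delivers p i v t) (h' : e.Delivers p i v' t') : v = v' ∧ t = t' := by
  obtain ⟨h0, d, hd, rfl⟩ := h
  obtain ⟨h0', d', hd', rfl⟩ := h'
  have h1 := he.lt_of_delivers hp h0 hd'
  have h2 := he.lt_of_delivers hp h0' hd
  obtain rfl : t = t' := by omega
  rw [hd] at hd'
  cases hd'
  exact ⟨rfl, rfl⟩

theorem delivers_of_broadcasts (he : e.IsExecution R) (hn : n = 3 * f + 1) (hR : 1 < R)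
    (hbyz : e.byz.card ≤ f) {i p : Fin n} {v : V} {r : ℕ} (hb : e.Broadcasts i v r)
    (hi : e.CorrectThrough (r + 3 * R) i) (hp : e.CorrectThrough (r + 3 * R) p) :
    ∃ t, r ≤ t ∧ t ≤ r + 3 * R ∧ e.Delivers p i v t := by
  obtain ⟨u, hu, hu0, d, hud⟩ := he.exists_delivery hi.1 (he.broadcaster_delivers hi.1 hb.1
    (he.not_dead_of_correctThrough hi (by omega)))
  have hpd := he.all_deliver hn hbyz hi.1 hp.1 hu0 hud
    (he.not_dead_of_correctThrough hi (by omega)) (he.not_dead_of_correctThrough hp (by omega))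
  obtain ⟨t, ht, ht0, d', htd⟩ := he.exists_delivery hp.1 hpd
  obtain ⟨hr, hreq, -⟩ := he.broadcasts_of_dlv hp.1 hi.1 htd
  rw [hb.1] at hreq
  simp only [Option.some.injEq, Prod.mk.injEq] at hreq
  exact ⟨t, by omega, by omega, ht0, d', htd, hreq.2.symm⟩

end Run.IsExecution

theorem Run.Correct.correctThrough {n f : ℕ} {V : Type*} {e : Run n f V} {p : Fin n}
    (h : e.Correct p) (t : ℕ) : e.CorrectThrough t p :=
  ⟨h.1, fun t' _ => h.2 (t' + 1)⟩

end RTByzCast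

theorem mainTheorem3 {n f R : ℕ} {V : Type*} (hn : n = 3 * f + 1) (hR : 1 < R)
    (e : RTByzCast.Run n f V) (he : e.IsExecution R) (hbyz : e.byz.card ≤ f) :
    RTBRB.Validity e.Correct e.Broadcasts e.Delivers ∧
    RTBRB.NoDuplication e.Correct e.Delivers ∧
    RTBRB.Integrity e.Correct e.Broadcasts e.Delivers ∧
    RTBRB.Agreement e.Correct e.Delivers ∧
    RTBRB.Timeliness (3 * R) e.Correct e.Broadcasts e.Delivers ∧
    (∀ i v r, e.Broadcasts i v r → e.CorrectThrough (r + 3 * R) i →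
      ∀ p, e.CorrectThrough (r + 3 * R) p → ∃ t, r ≤ t ∧ t ≤ r + 3 * R ∧ e.Delivers p i v t) := by
  refine ⟨fun i v r hi hb => ?_, fun p i v v' t t' hp h h' => he.delivers_unique hp.1 h h', ?_, ?_,
    fun i v r p t hi hb hp h => ?_, fun i v r hb hi p hp =>
      he.delivers_of_broadcasts hn hR hbyz hb hi hp⟩
  · obtain ⟨t, hr, -, ht⟩ := he.delivers_of_broadcasts hn hR hbyz hb
      (hi.correctThrough _) (hi.correctThrough _)
    exact ⟨i, t, hi, hr, ht⟩
  · rintro p i v t hp hi ⟨-, d, hd, rfl⟩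
    exact ⟨_, he.broadcasts_of_dlv hp.1 hi.1 hd⟩
  · rintro p q i v t hp hq ⟨h0, d, hd, rfl⟩
    -- Delivery spreads from `p` whoever the sender is; that the values coincide is `msg_unique`.
    have h := he.all_deliver hn hbyz hp.1 hq.1 h0 hd (hp.2 _) (hq.2 _)
    obtain ⟨t', -, h0', d', hd'⟩ := he.exists_delivery hq.1 h
    exact ⟨t', h0', d', hd', by rw [he.msg_unique hn hbyz hp.1 hq.1 hd hd']⟩
  · obtain ⟨t', -, ht', h'⟩ := he.delivers_of_broadcasts hn hR hbyz hb
      (hi.correctThrough _) (hp.correctThrough _)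
    rw [(he.delivers_unique hp.1 h h').2]
    exact ht'
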